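/- **Setting.** Let $M\ge 1$, let $\Omega\subset\mathbb R^M$ be open and bounded, and let $\Omega_1\subset\Omega$ be a bounded connected nonempty open set with Lipschitz boundary. Let $\gamma>0$, $0<\underline a<\overline a$ and $\tilde\gamma=\min\{1,\gamma\}$, and let $C_F>0$ be a constant in the Friedrichs inequality $$\|v\|_{H^1(\Omega_1)}^2\le C_F\Big[\int_{\Omega_1}|\nabla v|^2\,dx+\int_{\partial\Omega_1}v^2\,ds\Big]\qquad\text{for all } v\in H^1(\Omega_1),$$ where boundary values are traces. Let $f\in L^\infty(\Omega)$, $a^*\in L^2(\Omega)$, and let $b\in L^\infty(\Omega)$ satisfy $0<b<\overline b$ a.e. on $\Omega$, where $\overline b<\underline a\tilde\gamma/C_F$. Since the boundary values of a coefficient on $\partial\Omega_1$ enter the problem, a coefficient is an essentially bounded function $a$ on $\Omega$ together with essentially bounded boundary values on $\partial\Omega_1$; that is, $a\in X:=L^\infty(dx|_\Omega+ds|_{\partial\Omega_1})$, where $ds$ is surface measure. Let $\mathbb A$ be the set of all $a\in X$ with $\underline a<a<\overline a$ a.e. (on $\Omega$ and on $\partial\Omega_1$), or, alternatively, the set of all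 $a\in X$ with $\underline a\le a\le\overline a$ a.e. For $a\in\mathbb A$ let $U(a)\in H^1(\Omega_1)$ be the unique weak solution of $-\operatorname{div}(a\nabla u)-bu=f$ in $\Omega_1$, $\nabla u\cdot\vec n+\gamma u=0$ on $\partial\Omega_1$, that is, $$\int_{\Omega_1}a\nabla u\cdot\nabla v\,dx+\int_{\partial\Omega_1}a\gamma uv\,ds-\int_{\Omega_1}buv\,dx=\int_{\Omega_1}fv\,dx\qquad\text{for all } v\in H^1(\Omega_1),$$ and let $U'(a):X\to H^1(\Omega_1)$ be the Fréchet derivative of $U:\mathbb A\to H^1(\Omega_1)$ at $a$. For $z\in H^1(\Omega_1)$ put $$G_z(a)=\frac12\int_{\Omega_1}a|\nabla(U(a)-z)|^2\,dx+\frac12\int_{\partial\Omega_1}a\gamma(U(a)-z)^2\,ds-\frac12\int_{\Omega_1}b(U(a)-z)^2\,dx .$$ Let $\hat u\in H^1(\Omega_1)$, and let $a^+$ be an $a^*$-minimum-norm solution: $a^+\in\mathbb A$, $U(a^+)=\hat u$, and $\|a^+-a^*\|_{L^2(\Omega)}\le\|a-a^*\|_{L^2(\Omega)}$ for all $a\in\mathbb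 A$ with $U(a)=\hat u$. **Theorem.** Assume that there is $\omega^*\in H^{-1}(\Omega_1):=H^1(\Omega_1)^*$ such that the source condition $a^+-a^*=U'(a^+)^*\omega^*$ holds, that is, $$\int_\Omega(a^+-a^*)h\,dx=\langle\omega^*,U'(a^+)h\rangle\qquad\text{for all } h\in X .$$ Then $\|a^\delta_\rho-a^+\|_{L^2(\Omega)}=O(\sqrt\delta)$ and $\|U(a^\delta_\rho)-z^\delta\|_{H^1(\Omega_1)}=O(\delta)$ for $\rho\sim\delta\to0$, in the following uniform sense. For all $c_1>0$ and $c_2\in\mathbb R$ there is a constant $C$ such that for all $\delta>0$, all $\rho$ with $c_1\delta\le\rho\le c_2\delta$, all $z^\delta\in H^1(\Omega_1)$ with $\|\hat u-z^\delta\|_{H^1(\Omega_1)}\le\delta$, and every minimizer $a^\delta_\rho$ over $\mathbb A$ of $a\mapsto G_{z^\delta}(a)+\rho\|a-a^*\|^2_{L^2(\Omega)}$, $$\|a^\delta_\rho-a^+\|_{L^2(\Omega)}\le C\sqrt\delta\quad\text{and}\quad\|U(a^\delta_\rho)-z^\delta\|_{H^1(\Omega_1)}\le C\delta .$$ No smallness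 of $\omega^*$ is required. -/

import Mathlib

open MeasureTheory Set Filter Topology
open scoped NNReal ENNReal ContDiff InnerProductSpace

noncomputable section

namespace RobinTikhonov

/-- The Euclidean space `ℝ^M`. -/
abbrev Space (M : ℕ) := EuclideanSpace ℝ (Fin M)

variable {M : ℕ}

/-- Near each boundary point, after a choice of the "vertical" unit direction `e`, the set is the
part of the space strictly above the graph of a Lipschitz function of the component
`y - ⟪e, y⟫ e` orthogonal to `e`. -/
def HasLipschitzBoundary (D : Set (Space M)) : Prop :=
  ∀ x ∈ frontier D, ∃ e : Space M, ‖e‖ = 1 ∧ ∃ (K : ℝ≥0) (h : Space M → ℝ),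
    LipschitzWith K h ∧ ∀ᶠ y in 𝓝 x, (y ∈ D ↔ h (y - ⟪e, y⟫_ℝ • e) < ⟪e, y⟫_ℝ)

/-! ### The Sobolev space `H¹(D)` -/

/-- `g` is the weak gradient of `u` on `D`: `∫_D u ∇φ = - ∫_D φ g` for every test function
`φ ∈ C_c^∞(D)`. -/
def IsWeakGradient (D : Set (Space M)) (u : Space M → ℝ) (g : Space M → Space M) : Prop :=
  ∀ φ : Space M → ℝ, ContDiff ℝ ∞ φ → HasCompactSupport φ → tsupport φ ⊆ D →
    ∫ x in D, u x • gradient φ x = - ∫ x in D, φ x • g x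

/-- `L²(D) × L²(D; ℝ^M)` with the Hilbert norm `(‖u‖² + ‖g‖²)^{1/2}`. -/
abbrev L2Pair (D : Set (Space M)) :=
  WithLp 2 (Lp ℝ 2 (volume.restrict D) × Lp (Space M) 2 (volume.restrict D))

theorem integrable_test {D : Set (Space M)} {F : Type*} [NormedAddCommGroup F] [NormedSpace ℝ F]
    {φ : Space M → ℝ} (hφ : ContDiff ℝ ∞ φ) (hc : HasCompactSupport φ)
    {g : Space M → F} (hg : MemLp g 2 (volume.restrict D)) :
    Integrable (fun x => φ x • g x) (volume.restrict D) := by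
  have h : MemLp φ 2 (volume.restrict D) :=
    (hφ.continuous.memLp_of_hasCompactSupport (μ := volume) hc).restrict D
  exact memLp_one_iff_integrable.1 (hg.smul h)

theorem integrable_gradient_test {D : Set (Space M)}
    {φ : Space M → ℝ} (hφ : ContDiff ℝ ∞ φ) (hc : HasCompactSupport φ)
    {u : Space M → ℝ} (hu : MemLp u 2 (volume.restrict D)) :
    Integrable (fun x => u x • gradient φ x) (volume.restrict D) := by
  have hcont : Continuous (gradient φ) :=
    (InnerProductSpace.toDual ℝ (Space M)).symm.continuous.comp
      (hφ.continuous_fderiv (by simp))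
  have hs : HasCompactSupport (gradient φ) :=
    (hc.fderiv (𝕜 := ℝ)).comp_left
      (g := (InnerProductSpace.toDual ℝ (Space M)).symm) (map_zero _)
  have h : MemLp (gradient φ) 2 (volume.restrict D) :=
    (hcont.memLp_of_hasCompactSupport (μ := volume) hs).restrict D
  exact memLp_one_iff_integrable.1 (h.smul hu)

/-- `H¹(D)`, realized as the space of pairs `(u, ∇u)`, where `u ∈ L²(D)` has the weak gradient
`∇u ∈ L²(D; ℝ^M)`. -/
def sobolevH1 (D : Set (Space M)) : Submodule ℝ (L2Pair D) where
  carrier := {p | IsWeakGradient D p.fst p.snd}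
  zero_mem' := by
    intro φ _ _ _
    have h1 : (fun x => ((0 : L2Pair D).fst : Space M → ℝ) x • gradient φ x)
        =ᵐ[volume.restrict D] 0 := by
      filter_upwards [Lp.coeFn_zero ℝ 2 (volume.restrict D)] with x hx
      rw [WithLp.zero_fst, hx, Pi.zero_apply, zero_smul, Pi.zero_apply]
    have h2 : (fun x => φ x • ((0 : L2Pair D).snd : Space M → Space M) x)
        =ᵐ[volume.restrict D] 0 := by
      filter_upwards [Lp.coeFn_zero (Space M) 2 (volume.restrict D)] with x hx
      rw [WithLp.zero_snd, hx, Pi.zero_apply, smul_zero]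
    rw [integral_congr_ae h1, integral_congr_ae h2]
    simp
  add_mem' := by
    intro p q hp hq φ hφ hc hs
    have h1 : (fun x => ((p + q).fst : Space M → ℝ) x • gradient φ x)
        =ᵐ[volume.restrict D] fun x => p.fst x • gradient φ x + q.fst x • gradient φ x := by
      filter_upwards [Lp.coeFn_add p.fst q.fst] with x hx
      rw [WithLp.add_fst, hx, Pi.add_apply, add_smul]
    have h2 : (fun x => φ x • ((p + q).snd : Space M → Space M) x)
        =ᵐ[volume.restrict D] fun x => φ x • p.snd x + φ x • q.snd x := by
      filter_upwards [Lp.coeFn_add p.snd q.snd] with x hx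
      rw [WithLp.add_snd, hx, Pi.add_apply, smul_add]
    rw [integral_congr_ae h1, integral_congr_ae h2,
      integral_add (integrable_gradient_test hφ hc (Lp.memLp p.fst))
        (integrable_gradient_test hφ hc (Lp.memLp q.fst)),
      integral_add (integrable_test hφ hc (Lp.memLp p.snd))
        (integrable_test hφ hc (Lp.memLp q.snd)),
      hp φ hφ hc hs, hq φ hφ hc hs, neg_add]
  smul_mem' := by
    intro c p hp φ hφ hc hs
    have h1 : (fun x => ((c • p).fst : Space M → ℝ) x • gradient φ x)
        =ᵐ[volume.restrict D] fun x => c • (p.fst x • gradient φ x) := by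
      filter_upwards [Lp.coeFn_smul c p.fst] with x hx
      rw [WithLp.smul_fst, hx, Pi.smul_apply, smul_assoc]
    have h2 : (fun x => φ x • ((c • p).snd : Space M → Space M) x)
        =ᵐ[volume.restrict D] fun x => c • (φ x • p.snd x) := by
      filter_upwards [Lp.coeFn_smul c p.snd] with x hx
      rw [WithLp.smul_snd, hx, Pi.smul_apply, smul_comm]
    rw [integral_congr_ae h1, integral_congr_ae h2, integral_smul, integral_smul,
      hp φ hφ hc hs, smul_neg]

/-- `H¹(D)` with the norm `(‖u‖²_{L²} + ‖∇u‖²_{L²})^{1/2}` and the corresponding inner product. -/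
abbrev H1 (D : Set (Space M)) := ↥(sobolevH1 D)

/-- The function `u` itself. -/
def H1.fn {D : Set (Space M)} (u : H1 D) : Lp ℝ 2 (volume.restrict D) := (u : L2Pair D).fst

/-- The weak gradient `∇u`. -/
def H1.grad {D : Set (Space M)} (u : H1 D) : Lp (Space M) 2 (volume.restrict D) :=
  (u : L2Pair D).snd

/-! ### Boundary values -/

/-- Surface measure on `∂D`: the `(M-1)`-dimensional Hausdorff measure, normalized so that it
agrees with Lebesgue measure on `(M-1)`-dimensional subspaces. -/
def surfaceMeasure (D : Set (Space M)) : Measure (Space M) :=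
  (μHE[M - 1] : Measure (Space M)).restrict (frontier D)

/-- `T : H¹(D) → L²(∂D)` is bounded and linear, and `T u = u|_{∂D}` whenever `u ∈ H¹(D)` is
continuous up to the boundary. -/
def IsTraceOperator (D : Set (Space M)) (T : H1 D →L[ℝ] Lp ℝ 2 (surfaceMeasure D)) : Prop :=
  ∀ (u : H1 D) (φ : Space M → ℝ), ContinuousOn φ (closure D) →
    u.fn =ᵐ[volume.restrict D] φ → T u =ᵐ[surfaceMeasure D] φ

open Classical in
/-- The trace operator `H¹(D) → L²(∂D)`. On a bounded Lipschitz domain there is exactly one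
operator with the property `IsTraceOperator`. -/
def trace (D : Set (Space M)) : H1 D →L[ℝ] Lp ℝ 2 (surfaceMeasure D) :=
  if h : ∃ T, IsTraceOperator D T then h.choose else 0

/-! ### Coefficients -/

/-- Lebesgue measure on `Ω` plus surface measure on `∂Ω₁`. For a Lipschitz domain `Ω₁` these two
are mutually singular, so that an essentially bounded function for this measure is a function in
`L^∞(Ω)` together with boundary values in `L^∞(∂Ω₁)`. -/
def coeffMeasure (Ω Ω₁ : Set (Space M)) : Measure (Space M) :=
  volume.restrict Ω + surfaceMeasure Ω₁

/-- The space of coefficients, with the essential supremum over `Ω` and `∂Ω₁` as its norm. -/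
abbrev Coeff (Ω Ω₁ : Set (Space M)) := Lp ℝ ∞ (coeffMeasure Ω Ω₁)

/-- Coefficients with `aLo < a < aHi` almost everywhere. -/
def admissible (Ω Ω₁ : Set (Space M)) (aLo aHi : ℝ) : Set (Coeff Ω Ω₁) :=
  {a | ∀ᵐ x ∂(coeffMeasure Ω Ω₁), aLo < a x ∧ a x < aHi}

/-- Coefficients with `aLo ≤ a ≤ aHi` almost everywhere. -/
def closedAdmissible (Ω Ω₁ : Set (Space M)) (aLo aHi : ℝ) : Set (Coeff Ω Ω₁) :=
  {a | ∀ᵐ x ∂(coeffMeasure Ω Ω₁), aLo ≤ a x ∧ a x ≤ aHi}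

/-- The norm of `L²(Ω)`, for functions in `L²(Ω)`. -/
def normL2 (Ω : Set (Space M)) (g : Space M → ℝ) : ℝ :=
  (eLpNorm g 2 (volume.restrict Ω)).toReal

/-! ### The boundary value problem and its solution operator -/

/-- `∫_{Ω₁} a ∇u·∇v + ∫_{∂Ω₁} a γ u v - ∫_{Ω₁} b u v`. -/
def robinForm {Ω Ω₁ : Set (Space M)} (γ : ℝ) (b : Space M → ℝ) (a : Coeff Ω Ω₁)
    (u v : H1 Ω₁) : ℝ :=
  (∫ x in Ω₁, a x * ⟪u.grad x, v.grad x⟫_ℝ)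
    + (∫ x, a x * γ * trace Ω₁ u x * trace Ω₁ v x ∂(surfaceMeasure Ω₁))
    - ∫ x in Ω₁, b x * u.fn x * v.fn x

/-- `u` is a weak solution of `-div(a ∇u) - b u = f` in `Ω₁`, `∇u·n + γ u = 0` on `∂Ω₁`. -/
def IsWeakSolution {Ω Ω₁ : Set (Space M)} (γ : ℝ) (b f : Space M → ℝ) (a : Coeff Ω Ω₁)
    (u : H1 Ω₁) : Prop :=
  ∀ v : H1 Ω₁, robinForm γ b a u v = ∫ x in Ω₁, f x * v.fn x

open Classical in
/-- The coefficient-to-solution operator `U`: the unique weak solution, where there is one (this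
includes every admissible coefficient), and `0` otherwise. -/
def solutionMap {Ω Ω₁ : Set (Space M)} (γ : ℝ) (b f : Space M → ℝ) (a : Coeff Ω Ω₁) : H1 Ω₁ :=
  if h : ∃! u, IsWeakSolution γ b f a u then h.choose else 0

/-! ### Tikhonov regularization -/

/-- `G_z(a) = 1/2 ∫_{Ω₁} a |∇(U(a)-z)|² + 1/2 ∫_{∂Ω₁} a γ (U(a)-z)² - 1/2 ∫_{Ω₁} b (U(a)-z)²`. -/
def energyMisfit {Ω Ω₁ : Set (Space M)} (γ : ℝ) (b f : Space M → ℝ) (z : H1 Ω₁)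
    (a : Coeff Ω Ω₁) : ℝ :=
  1 / 2 * robinForm γ b a (solutionMap γ b f a - z) (solutionMap γ b f a - z)

/-- `G_z(a) + ρ ‖a - a*‖²_{L²(Ω)}`. -/
def tikhonov {Ω Ω₁ : Set (Space M)} (γ : ℝ) (b f aStar : Space M → ℝ) (ρ : ℝ) (z : H1 Ω₁)
    (a : Coeff Ω Ω₁) : ℝ :=
  energyMisfit γ b f z a + ρ * normL2 Ω (fun x => a x - aStar x) ^ 2

/-- `a` minimizes the Tikhonov functional over the set `A`. -/
def IsTikhonovMinimizer {Ω Ω₁ : Set (Space M)} (γ : ℝ) (b f aStar : Space M → ℝ)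
    (A : Set (Coeff Ω Ω₁)) (ρ : ℝ) (z : H1 Ω₁) (a : Coeff Ω Ω₁) : Prop :=
  a ∈ A ∧ ∀ a' ∈ A, tikhonov γ b f aStar ρ z a ≤ tikhonov γ b f aStar ρ z a'

/-- `a` is an `a*`-minimum-norm solution of `U(a) = uHat` in `A`. -/
def IsMinNormSolution {Ω Ω₁ : Set (Space M)} (γ : ℝ) (b f aStar : Space M → ℝ)
    (A : Set (Coeff Ω Ω₁)) (uHat : H1 Ω₁) (a : Coeff Ω Ω₁) : Prop :=
  a ∈ A ∧ solutionMap γ b f a = uHat ∧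
    ∀ a' ∈ A, solutionMap γ b f a' = uHat →
      normL2 Ω (fun x => a x - aStar x) ^ 2 ≤ normL2 Ω (fun x => a' x - aStar x) ^ 2

/-- `a - a* = U'(a)^* ω*` in the dual of the coefficient space, where `a - a*` acts through
`h ↦ ∫_Ω (a - a*) h`, and `U'(a)` is the Fréchet derivative of `U : A → H¹(Ω₁)` for the norm
of the coefficient space. -/
def SourceCondition {Ω Ω₁ : Set (Space M)} (γ : ℝ) (b f aStar : Space M → ℝ)
    (A : Set (Coeff Ω Ω₁)) (a : Coeff Ω Ω₁) (ωStar : StrongDual ℝ (H1 Ω₁)) : Prop :=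
  ∀ h : Coeff Ω Ω₁,
    ∫ x in Ω, (a x - aStar x) * h x = ωStar (fderivWithin ℝ (solutionMap γ b f) A a h)

end RobinTikhonov

end

open RobinTikhonov

/-!
Write `B_a(u, v)` for the form of the Robin problem. It is affine in `a`, bounded uniformly for
admissible `a`, and by the Friedrichs inequality coercive uniformly for admissible `a`
(`robinForm_coercive`). Everything else happens in an abstract Hilbert space.

Implicit differentiation of `B_a(U(a), ·) = ∫ f ·` gives `U'(a⁺)`
(`hasFDerivWithinAt_solution`); the admissible set is convex with nonempty interior in `L^∞`, so
this is the only derivative within it. If `w` solves the adjoint problem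
`B_{a⁺}(·, w) = ω*`, then
`ω*(U'(a⁺)(a⁺ - a)) = B_a(U(a⁺), w) - B_{a⁺}(U(a⁺), w) = B_a(U(a⁺) - U(a), w)`,
because both states have the same right hand side. So the source functional is at most a constant
times `‖U(a⁺) - U(a)‖`, without a quadratic remainder (`exists_source_bound`), and this is why
`ω*` need not be small.

Comparing the Tikhonov functional at a minimizer `a` and at `a⁺`, and expanding `‖a - a*‖²` around
`a⁺`, leaves
`c/2 ‖U(a) - z‖² + ρ ‖a - a⁺‖² ≤ K/2 δ² + 2 ρ ω*(U'(a⁺)(a⁺ - a))`. The last term is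
at most a constant times `ρ (δ + ‖U(a) - z‖)`; as `ρ ≤ c₂ δ`, Young's inequality absorbs it
(`rates_of_energy_inequality`), and both rates follow (`exists_tikhonov_rates`).
-/

namespace RobinTikhonov

/-! ### Coercive bilinear forms depending linearly on a coefficient -/

section Abstract

set_option maxSynthPendingDepth 3

variable {X H Y : Type*} [NormedAddCommGroup X] [NormedSpace ℝ X]
  [NormedAddCommGroup H] [InnerProductSpace ℝ H]
  [NormedAddCommGroup Y] [InnerProductSpace ℝ Y]

theorem exists_solutionOperator_of_coercive [CompleteSpace H] {B : H →L[ℝ] H →L[ℝ] ℝ} {c : ℝ}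
    (hc : 0 < c) (hB : ∀ v, c * ‖v‖ ^ 2 ≤ B v v) :
    ∃ S : StrongDual ℝ H →L[ℝ] H, ∀ φ v, B (S φ) v = φ v := by
  have h : IsCoercive B := ⟨c, hc, fun u => by simpa [sq, mul_assoc] using hB u⟩
  refine ⟨LinearMap.mkContinuous
    { toFun := fun φ => h.continuousLinearEquivOfBilin.symm ((InnerProductSpace.toDual ℝ H).symm φ)
      map_add' := fun φ ψ => by simp
      map_smul' := fun r φ => by simp }
    ‖(h.continuousLinearEquivOfBilin.symm : H →L[ℝ] H)‖ fun φ => ?_, fun φ v => ?_⟩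
  · have := (h.continuousLinearEquivOfBilin.symm : H →L[ℝ] H).le_opNorm
      ((InnerProductSpace.toDual ℝ H).symm φ)
    rwa [LinearIsometryEquiv.norm_map] at this
  · change B (h.continuousLinearEquivOfBilin.symm ((InnerProductSpace.toDual ℝ H).symm φ)) v = φ v
    rw [← h.continuousLinearEquivOfBilin_apply, ContinuousLinearEquiv.apply_symm_apply,
      InnerProductSpace.toDual_symm_apply]

theorem mul_norm_le_of_coercive {B : H →L[ℝ] H →L[ℝ] ℝ} {c m : ℝ}
    (hB : ∀ v, c * ‖v‖ ^ 2 ≤ B v v) (hm : 0 ≤ m) {u : H} (hu : ∀ v, B u v ≤ m * ‖v‖) :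
    c * ‖u‖ ≤ m := by
  rcases (norm_nonneg u).eq_or_lt with h | h
  · rwa [← h, mul_zero]
  · refine le_of_mul_le_mul_right ?_ h
    calc c * ‖u‖ * ‖u‖ = c * ‖u‖ ^ 2 := by ring
      _ ≤ m * ‖u‖ := (hB u).trans (hu u)

theorem eq_of_coercive {B : H →L[ℝ] H →L[ℝ] ℝ} {c : ℝ} (hc : 0 < c)
    (hB : ∀ v, c * ‖v‖ ^ 2 ≤ B v v) {u u' : H} (h : ∀ v, B u v = B u' v) : u = u' := by
  have := mul_norm_le_of_coercive hB le_rfl (u := u - u') fun v => by simp [h v]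
  exact sub_eq_zero.1 (norm_le_zero_iff.1 (nonpos_of_mul_nonpos_right this hc))

/-- Implicit differentiation of `P a (U a) - N (U a) = ℓ`: the derivative of `U` at `a` in the
direction `h` is the solution `u'` of `P a u' - N u' = - P h (U a)`. -/
theorem hasFDerivWithinAt_solution {P : X →L[ℝ] H →L[ℝ] H →L[ℝ] ℝ} {N : H →L[ℝ] H →L[ℝ] ℝ}
    {A : Set X} {c : ℝ} (hc : 0 < c)
    (hcoer : ∀ a ∈ A, ∀ v, c * ‖v‖ ^ 2 ≤ (P a - N) v v)
    {ℓ : StrongDual ℝ H} {U : X → H} (hU : ∀ a ∈ A, ∀ v, (P a - N) (U a) v = ℓ v)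
    {a : X} (ha : a ∈ A) {S : StrongDual ℝ H →L[ℝ] H} (hS : ∀ φ v, (P a - N) (S φ) v = φ v) :
    HasFDerivWithinAt U (-(S ∘L P.flip (U a))) A a := by
  have bound : ∀ h u v, P h u v ≤ ‖P‖ * ‖h‖ * ‖u‖ * ‖v‖ := fun h u v =>
    (le_abs_self _).trans <| ((P h).le_opNorm₂ u v).trans <| by gcongr; exact P.le_opNorm h
  have lip : ∀ a' ∈ A, ‖U a' - U a‖ ≤ ‖P‖ * ‖a' - a‖ * ‖U a‖ / c := by
    intro a' ha'
    rw [le_div_iff₀' hc]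
    refine mul_norm_le_of_coercive (hcoer a' ha') (by positivity) fun v => ?_
    have h1 := hU a' ha' v
    have h2 := hU a ha v
    have h3 := bound (a' - a) (-U a) v
    simp only [sub_apply, map_sub, map_neg, neg_apply,
      norm_neg] at h1 h2 h3 ⊢
    linarith
  rw [hasFDerivWithinAt_iff_isLittleO]
  refine Asymptotics.IsBigO.trans_isLittleO (g := fun a' => ‖a' - a‖ ^ 2) ?_
    ((Asymptotics.isLittleO_pow_sub_sub a one_lt_two).mono nhdsWithin_le_nhds)
  refine Asymptotics.IsBigO.of_bound (‖P‖ * (‖P‖ * ‖U a‖ / c) / c) ?_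
  filter_upwards [self_mem_nhdsWithin] with a' ha'
  rw [norm_pow, norm_norm]
  have key : c * ‖U a' - U a - (-(S ∘L P.flip (U a))) (a' - a)‖
      ≤ ‖P‖ * ‖a' - a‖ * ‖U a' - U a‖ := by
    refine mul_norm_le_of_coercive (hcoer a ha) (by positivity) fun v => ?_
    have h1 := hU a' ha' v
    have h2 := hU a ha v
    have h3 := hS (P (a' - a) (U a)) v
    have h4 := bound (a' - a) (-(U a' - U a)) v
    simp only [sub_apply, map_sub, map_neg, neg_apply,
      norm_neg, ContinuousLinearMap.comp_apply, ContinuousLinearMap.flip_apply] at h1 h2 h3 h4 ⊢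
    linarith
  rw [← le_div_iff₀' hc] at key
  calc _ ≤ _ := key
    _ ≤ ‖P‖ * ‖a' - a‖ * (‖P‖ * ‖a' - a‖ * ‖U a‖ / c) / c := by gcongr; exact lip a' ha'
    _ = _ := by ring

/-- The source functional evaluated at `a₀ - a` is the residual at the exact solution `U a₀` of
the equation with coefficient `a`, tested with the solution `w` of the adjoint equation at `a₀`
for the data `η`. Hence it is controlled by `‖U a₀ - U a‖`, with no smallness of `η`. -/
theorem exists_source_bound [CompleteSpace H]
    {P : X →L[ℝ] H →L[ℝ] H →L[ℝ] ℝ} {N : H →L[ℝ] H →L[ℝ] ℝ}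
    {A : Set X} {c K : ℝ} (hc : 0 < c)
    (hcoer : ∀ a ∈ A, ∀ v, c * ‖v‖ ^ 2 ≤ (P a - N) v v) (hK : ∀ a ∈ A, ‖P a - N‖ ≤ K)
    {ℓ : StrongDual ℝ H} {U : X → H} (hU : ∀ a ∈ A, ∀ v, (P a - N) (U a) v = ℓ v)
    {a₀ : X} (ha₀ : a₀ ∈ A) (hA : UniqueDiffWithinAt ℝ A a₀) (η : StrongDual ℝ H) :
    ∃ W : ℝ, 0 ≤ W ∧ ∀ a ∈ A, η (fderivWithin ℝ U A a₀ (a₀ - a)) ≤ K * ‖U a₀ - U a‖ * W := by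
  obtain ⟨S, hS⟩ := exists_solutionOperator_of_coercive hc (hcoer a₀ ha₀)
  obtain ⟨S', hS'⟩ := exists_solutionOperator_of_coercive (B := (P a₀ - N).flip) hc (hcoer a₀ ha₀)
  refine ⟨‖S' η‖, norm_nonneg _, fun a ha => ?_⟩
  rw [(hasFDerivWithinAt_solution hc hcoer hU ha₀ hS).fderivWithin hA]
  have h1 := hS' η (S (P (a₀ - a) (U a₀)))
  rw [ContinuousLinearMap.flip_apply, hS] at h1
  have h2 := hU a₀ ha₀ (S' η)
  have h3 := hU a ha (S' η)
  have h4 : (P a - N) (U a₀ - U a) (S' η) ≤ K * ‖U a₀ - U a‖ * ‖S' η‖ :=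
    (le_abs_self _).trans <| ((P a - N).le_opNorm₂ _ _).trans <| by gcongr; exact hK a ha
  simp only [sub_apply, map_sub, map_neg, neg_apply,
    ContinuousLinearMap.comp_apply, ContinuousLinearMap.flip_apply] at h1 h2 h3 h4 ⊢
  linarith

/-- Absorption of the term linear in `e` by Young's inequality. -/
theorem rates_of_energy_inequality {c c₁ c₂ K V δ ρ e d : ℝ} (hc : 0 < c) (hc₁ : 0 < c₁)
    (hV : 0 ≤ V) (hδ : 0 < δ) (he : 0 ≤ e)
    (hρ₁ : c₁ * δ ≤ ρ) (hρ₂ : ρ ≤ c₂ * δ)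
    (h : c / 2 * e ^ 2 + ρ * d ^ 2 ≤ K / 2 * δ ^ 2 + ρ * (V * (δ + e))) :
    d ≤ √((K / 2 + c₂ * V + (c₂ * V) ^ 2 / c) / c₁) * √δ ∧
      e ≤ √(4 * (K / 2 + c₂ * V + (c₂ * V) ^ 2 / c) / c) * δ := by
  set Q := K / 2 + c₂ * V + (c₂ * V) ^ 2 / c with hQ
  have hρ : 0 < ρ := (mul_pos hc₁ hδ).trans_le hρ₁
  have hc₂ : 0 < c₂ := pos_of_mul_pos_left (hρ.trans_le hρ₂) hδ.le
  have h1 : ρ * (V * (δ + e)) ≤ c₂ * δ * (V * (δ + e)) := by gcongr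
  have h2 : c₂ * V * δ * e ≤ c / 4 * e ^ 2 + (c₂ * V) ^ 2 / c * δ ^ 2 := by
    have h3 : c / 4 * e ^ 2 + (c₂ * V) ^ 2 / c * δ ^ 2 - c₂ * V * δ * e
        = (c * e / 2 - c₂ * V * δ) ^ 2 / c := by field_simp; ring
    have h4 : 0 ≤ (c * e / 2 - c₂ * V * δ) ^ 2 / c := by positivity
    linarith
  have h5 : c / 4 * e ^ 2 + ρ * d ^ 2 ≤ Q * δ ^ 2 := by rw [hQ]; linarith
  constructor
  · rw [← Real.sqrt_mul' _ hδ.le]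
    refine Real.le_sqrt_of_sq_le ?_
    have h6 : c₁ * δ * d ^ 2 ≤ Q * δ ^ 2 :=
      (by gcongr : c₁ * δ * d ^ 2 ≤ ρ * d ^ 2).trans (by nlinarith [sq_nonneg e])
    rw [div_mul_eq_mul_div, le_div_iff₀ hc₁]
    refine le_of_mul_le_mul_left ?_ hδ
    linarith
  · rw [← Real.sqrt_sq hδ.le, ← Real.sqrt_mul' _ (sq_nonneg δ)]
    refine Real.le_sqrt_of_sq_le ?_
    have h6 : 0 ≤ ρ * d ^ 2 := by positivity
    rw [div_mul_eq_mul_div, le_div_iff₀ hc]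
    linarith

/-- Convergence rates for Tikhonov regularization with an energy misfit, for a coefficient-to-
solution map `U` given by a family of coercive forms that is affine in the coefficient. The
regularization term is the distance from `J a` to `s` in an inner product space. -/
theorem exists_tikhonov_rates [CompleteSpace H]
    {P : X →L[ℝ] H →L[ℝ] H →L[ℝ] ℝ} {N : H →L[ℝ] H →L[ℝ] ℝ}
    {A : Set X} {c K : ℝ} (hc : 0 < c)
    (hcoer : ∀ a ∈ A, ∀ v, c * ‖v‖ ^ 2 ≤ (P a - N) v v) (hK : ∀ a ∈ A, ‖P a - N‖ ≤ K)
    {ℓ : StrongDual ℝ H} {U : X → H} (hU : ∀ a ∈ A, ∀ v, (P a - N) (U a) v = ℓ v)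
    {a₀ : X} (ha₀ : a₀ ∈ A) (hA : UniqueDiffWithinAt ℝ A a₀) {η : StrongDual ℝ H}
    (J : X →L[ℝ] Y) (s : Y) (hsource : ∀ h, ⟪J a₀ - s, J h⟫_ℝ = η (fderivWithin ℝ U A a₀ h))
    {c₁ : ℝ} (c₂ : ℝ) (hc₁ : 0 < c₁) :
    ∃ C : ℝ, ∀ δ ρ : ℝ, 0 < δ → c₁ * δ ≤ ρ → ρ ≤ c₂ * δ → ∀ z : H, ‖U a₀ - z‖ ≤ δ → ∀ a ∈ A,
      1 / 2 * (P a - N) (U a - z) (U a - z) + ρ * ‖J a - s‖ ^ 2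
        ≤ 1 / 2 * (P a₀ - N) (U a₀ - z) (U a₀ - z) + ρ * ‖J a₀ - s‖ ^ 2 →
      ‖J a - J a₀‖ ≤ C * √δ ∧ ‖U a - z‖ ≤ C * δ := by
  obtain ⟨W, hW, hsrc⟩ := exists_source_bound hc hcoer hK hU ha₀ hA η
  have hK0 : 0 ≤ K := (norm_nonneg _).trans (hK a₀ ha₀)
  set V := 2 * (K * W) with hV
  set Q := K / 2 + c₂ * V + (c₂ * V) ^ 2 / c with hQ
  refine ⟨√(Q / c₁) + √(4 * Q / c), fun δ ρ hδ hρ₁ hρ₂ z hz a ha hmin => ?_⟩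
  have hρ : 0 < ρ := (mul_pos hc₁ hδ).trans_le hρ₁
  have h1 := hcoer a ha (U a - z)
  have h2 : (P a₀ - N) (U a₀ - z) (U a₀ - z) ≤ K * δ ^ 2 :=
    calc _ ≤ ‖P a₀ - N‖ * ‖U a₀ - z‖ * ‖U a₀ - z‖ :=
          (le_abs_self _).trans ((P a₀ - N).le_opNorm₂ _ _)
      _ ≤ K * δ * δ := by gcongr; exact hK a₀ ha₀
      _ = K * δ ^ 2 := by ring
  have h3 : ⟪J a₀ - s, J a₀ - J a⟫_ℝ ≤ K * W * (δ + ‖U a - z‖) := by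
    rw [← map_sub, hsource]
    calc _ ≤ K * ‖U a₀ - U a‖ * W := hsrc a ha
      _ ≤ K * (δ + ‖U a - z‖) * W := by
          gcongr
          calc ‖U a₀ - U a‖ = ‖(U a₀ - z) - (U a - z)‖ := by rw [sub_sub_sub_cancel_right]
            _ ≤ ‖U a₀ - z‖ + ‖U a - z‖ := norm_sub_le _ _
            _ ≤ δ + ‖U a - z‖ := by gcongr
      _ = _ := by ring
  have h4 : ‖J a - J a₀‖ ^ 2
      = ‖J a - s‖ ^ 2 - ‖J a₀ - s‖ ^ 2 + 2 * ⟪J a₀ - s, J a₀ - J a⟫_ℝ := by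
    have h5 : J a - s = (J a₀ - s) - (J a₀ - J a) := by abel
    rw [h5, norm_sub_rev (J a), norm_sub_sq_real (J a₀ - s)]
    ring
  have h6 : ρ * ‖J a - J a₀‖ ^ 2 ≤ ρ * (‖J a - s‖ ^ 2 - ‖J a₀ - s‖ ^ 2)
      + ρ * (V * (δ + ‖U a - z‖)) := by
    rw [h4, ← mul_add]
    refine mul_le_mul_of_nonneg_left ?_ hρ.le
    rw [hV]
    linarith
  obtain ⟨hd, he⟩ := rates_of_energy_inequality (V := V) (K := K) hc hc₁ (by positivity) hδ
    (norm_nonneg (U a - z)) hρ₁ hρ₂ (d := ‖J a - J a₀‖) (by linarith)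
  exact ⟨hd.trans (by gcongr; exact le_add_of_nonneg_right (Real.sqrt_nonneg _)),
    he.trans (by gcongr; exact le_add_of_nonneg_left (Real.sqrt_nonneg _))⟩

end Abstract

/-! ### Weighted `L²` inner products and restriction of coefficients -/

section Weighted

set_option maxSynthPendingDepth 3

variable {α E : Type*} {m : MeasurableSpace α} {μ ν : Measure α}
  [NormedAddCommGroup E] [InnerProductSpace ℝ E]

/-- The trilinear form `(c, u, v) ↦ ∫ c ⟪u, v⟫ ∂ν` on `L^∞ × L² × L²`. -/
noncomputable def weightedInner (ν : Measure α) (E : Type*) [NormedAddCommGroup E]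
    [InnerProductSpace ℝ E] :
    Lp ℝ ∞ ν →L[ℝ] Lp E 2 ν →L[ℝ] Lp E 2 ν →L[ℝ] ℝ :=
  ContinuousLinearMap.compL ℝ (Lp E 2 ν) (Lp E 2 ν) (Lp E 2 ν →L[ℝ] ℝ)
      (isBoundedBilinearMap_inner (𝕜 := ℝ) (E := Lp E 2 ν)).toContinuousLinearMap
    ∘L (ContinuousLinearMap.lsmul ℝ ℝ : ℝ →L[ℝ] E →L[ℝ] E).holderL ν ∞ 2 2

theorem weightedInner_apply (c : Lp ℝ ∞ ν) (u v : Lp E 2 ν) :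
    weightedInner ν E c u v = ∫ x, c x * ⟪u x, v x⟫_ℝ ∂ν := by
  change ⟪(ContinuousLinearMap.lsmul ℝ ℝ : ℝ →L[ℝ] E →L[ℝ] E).holder 2 c u, v⟫_ℝ = _
  rw [L2.inner_def]
  refine integral_congr_ae ?_
  filter_upwards [(ContinuousLinearMap.lsmul ℝ ℝ : ℝ →L[ℝ] E →L[ℝ] E).coeFn_holder (r := 2) c u]
    with x hx
  rw [hx, ContinuousLinearMap.lsmul_apply, real_inner_smul_left]

theorem integrable_mul_inner (c : Lp ℝ ∞ ν) (u v : Lp E 2 ν) :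
    Integrable (fun x => c x * ⟪u x, v x⟫_ℝ) ν := by
  refine (L2.integrable_inner (𝕜 := ℝ)
    ((ContinuousLinearMap.lsmul ℝ ℝ : ℝ →L[ℝ] E →L[ℝ] E).holder 2 c u) v).congr ?_
  filter_upwards [(ContinuousLinearMap.lsmul ℝ ℝ : ℝ →L[ℝ] E →L[ℝ] E).coeFn_holder (r := 2) c u]
    with x hx
  rw [hx, ContinuousLinearMap.lsmul_apply, real_inner_smul_left]

theorem mul_norm_sq_eq_integral (r : ℝ) (u : Lp E 2 ν) :
    r * ‖u‖ ^ 2 = ∫ x, r * ⟪u x, u x⟫_ℝ ∂ν := by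
  rw [integral_const_mul, ← real_inner_self_eq_norm_sq, L2.inner_def]

theorem mul_norm_sq_le_weightedInner {c : Lp ℝ ∞ ν} {r : ℝ} (h : ∀ᵐ x ∂ν, r ≤ c x)
    (u : Lp E 2 ν) : r * ‖u‖ ^ 2 ≤ weightedInner ν E c u u := by
  rw [weightedInner_apply, mul_norm_sq_eq_integral]
  refine integral_mono_ae ((L2.integrable_inner (𝕜 := ℝ) u u).const_mul r)
    (integrable_mul_inner c u u) ?_
  filter_upwards [h] with x hx
  exact mul_le_mul_of_nonneg_right hx real_inner_self_nonneg

theorem weightedInner_le_mul_norm_sq {c : Lp ℝ ∞ ν} {r : ℝ} (h : ∀ᵐ x ∂ν, c x ≤ r)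
    (u : Lp E 2 ν) : weightedInner ν E c u u ≤ r * ‖u‖ ^ 2 := by
  rw [weightedInner_apply, mul_norm_sq_eq_integral]
  refine integral_mono_ae (integrable_mul_inner c u u)
    ((L2.integrable_inner (𝕜 := ℝ) u u).const_mul r) ?_
  filter_upwards [h] with x hx
  exact mul_le_mul_of_nonneg_right hx real_inner_self_nonneg

/-- Restriction of essentially bounded functions to a smaller measure. -/
noncomputable def restrictLpTop (h : ν ≤ μ) : Lp ℝ ∞ μ →L[ℝ] Lp ℝ ∞ ν :=
  Lp.LpToLpOfMeasureLeSMul (c := 1) ENNReal.one_ne_top (by rwa [one_smul])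

theorem coeFn_restrictLpTop (h : ν ≤ μ) (a : Lp ℝ ∞ μ) : restrictLpTop h a =ᵐ[ν] a :=
  Lp.coeFn_LpToLpOfMeasureLeSMul _ _ a

/-- The inclusion of `L^∞` into `L²` of a smaller finite measure. -/
noncomputable def lpTopToL2 [IsFiniteMeasure ν] (h : ν ≤ μ) : Lp ℝ ∞ μ →L[ℝ] Lp ℝ 2 ν :=
  ((ContinuousLinearMap.lsmul ℝ ℝ : ℝ →L[ℝ] ℝ →L[ℝ] ℝ).holderL ν ∞ 2 2).flip (Lp.const 2 ν 1)
    ∘L restrictLpTop h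

theorem coeFn_lpTopToL2 [IsFiniteMeasure ν] (h : ν ≤ μ) (a : Lp ℝ ∞ μ) :
    lpTopToL2 h a =ᵐ[ν] a := by
  filter_upwards [(ContinuousLinearMap.lsmul ℝ ℝ : ℝ →L[ℝ] ℝ →L[ℝ] ℝ).coeFn_holder (r := 2)
    (restrictLpTop h a) (Lp.const 2 ν (1 : ℝ)), coeFn_restrictLpTop h a,
    Lp.coeFn_const (p := 2) (μ := ν) (1 : ℝ)] with x h1 h2 h3
  refine Eq.trans h1 ?_
  rw [h2, h3]
  simp

theorem norm_le_of_ae_norm_le {c : Lp ℝ ∞ ν} {r : ℝ} (hr : 0 ≤ r) (h : ∀ᵐ x ∂ν, ‖c x‖ ≤ r) :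
    ‖c‖ ≤ r := by
  rw [Lp.norm_def, eLpNorm_exponent_top]
  exact ENNReal.toReal_le_of_le_ofReal hr (eLpNormEssSup_le_of_ae_bound h)

theorem ae_norm_le_norm (c : Lp ℝ ∞ ν) : ∀ᵐ x ∂ν, ‖c x‖ ≤ ‖c‖ := by
  rw [Lp.norm_def, toReal_eLpNorm (Lp.aestronglyMeasurable c)]
  exact ae_le_lpNorm_exponent_top (Lp.memLp c)

theorem convex_setOf_ae_mem {I : Set ℝ} (hI : Convex ℝ I) :
    Convex ℝ {c : Lp ℝ ∞ ν | ∀ᵐ x ∂ν, c x ∈ I} := by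
  intro c hc d hd s t hs ht hst
  simp only [mem_ofPred_eq] at hc hd ⊢
  filter_upwards [hc, hd, Lp.coeFn_add (s • c) (t • d), Lp.coeFn_smul s c, Lp.coeFn_smul t d]
    with x h1 h2 h3 h4 h5
  rw [h3, Pi.add_apply, h4, h5]
  exact hI h1 h2 hs ht hst

theorem nonempty_interior_setOf_ae_mem_Ioo {r s : ℝ} (hrs : r < s) :
    (interior {c : Lp ℝ ∞ ν | ∀ᵐ x ∂ν, c x ∈ Ioo r s}).Nonempty := by
  have hc : MemLp (fun _ : α => (r + s) / 2) ∞ ν := memLp_top_const _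
  refine ⟨hc.toLp, mem_interior.2
    ⟨Metric.ball hc.toLp ((s - r) / 2), fun c hc' => ?_, Metric.isOpen_ball,
      Metric.mem_ball_self (by linarith)⟩⟩
  rw [mem_ball_iff_norm] at hc'
  filter_upwards [ae_norm_le_norm (c - hc.toLp), Lp.coeFn_sub c hc.toLp, hc.coeFn_toLp]
    with x h1 h2 h3
  rw [h2, Pi.sub_apply, h3, Real.norm_eq_abs] at h1
  have := abs_lt.1 (h1.trans_lt hc')
  constructor <;> linarith

/-- The pullback of a family of bilinear forms under a linear map. -/
noncomputable def pullbackForm {X F H : Type*} [NormedAddCommGroup X] [NormedSpace ℝ X]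
    [NormedAddCommGroup F] [NormedSpace ℝ F] [NormedAddCommGroup H] [NormedSpace ℝ H]
    (T : H →L[ℝ] F) (W : X →L[ℝ] F →L[ℝ] F →L[ℝ] ℝ) : X →L[ℝ] H →L[ℝ] H →L[ℝ] ℝ :=
  (ContinuousLinearMap.compL ℝ H F (H →L[ℝ] ℝ)).flip T ∘L
    ContinuousLinearMap.compL ℝ F (F →L[ℝ] ℝ) (H →L[ℝ] ℝ)
      ((ContinuousLinearMap.compL ℝ H F ℝ).flip T) ∘L W

end Weighted

/-! ### The Robin problem in `H¹` -/

section Robin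

set_option maxSynthPendingDepth 3

variable {M : ℕ} {Ω Ω₁ D : Set (Space M)}

/-- `u ↦ u` as a bounded operator `H¹(D) → L²(D)`. -/
noncomputable def H1.fnL (D : Set (Space M)) : H1 D →L[ℝ] Lp ℝ 2 (volume.restrict D) :=
  WithLp.fstL 2 ℝ _ _ ∘L (sobolevH1 D).subtypeL

/-- `u ↦ ∇u` as a bounded operator `H¹(D) → L²(D; ℝ^M)`. -/
noncomputable def H1.gradL (D : Set (Space M)) : H1 D →L[ℝ] Lp (Space M) 2 (volume.restrict D) :=
  WithLp.sndL 2 ℝ _ _ ∘L (sobolevH1 D).subtypeL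

theorem H1.norm_sq_eq (u : H1 D) : ‖u‖ ^ 2 = ‖u.fn‖ ^ 2 + ‖u.grad‖ ^ 2 :=
  WithLp.prod_norm_sq_eq_of_L2 (u : L2Pair D)

theorem memLp_gradient_test {φ : Space M → ℝ} (hφ : ContDiff ℝ ∞ φ) (hc : HasCompactSupport φ) :
    MemLp (gradient φ) 2 (volume.restrict D) := by
  have hcont : Continuous (gradient φ) :=
    (InnerProductSpace.toDual ℝ (Space M)).symm.continuous.comp
      (hφ.continuous_fderiv (by simp))
  have hs : HasCompactSupport (gradient φ) :=
    (hc.fderiv (𝕜 := ℝ)).comp_left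
      (g := (InnerProductSpace.toDual ℝ (Space M)).symm) (map_zero _)
  exact (hcont.memLp_of_hasCompactSupport (μ := volume) hs).restrict D

/-- For a fixed test function, both sides of the identity that defines the weak gradient are
continuous in `L²(D) × L²(D; ℝ^M)`. -/
theorem isClosed_sobolevH1 (D : Set (Space M)) : IsClosed (sobolevH1 D : Set (L2Pair D)) := by
  have h : (sobolevH1 D : Set (L2Pair D)) = ⋂ (φ : Space M → ℝ) (_ : ContDiff ℝ ∞ φ)
      (_ : HasCompactSupport φ) (_ : tsupport φ ⊆ D),
      {p | ∫ x in D, p.fst x • gradient φ x = - ∫ x in D, φ x • p.snd x} := by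
    ext p
    simp only [mem_iInter]
    exact Iff.rfl
  rw [h]
  refine isClosed_iInter fun φ => isClosed_iInter fun hφ => isClosed_iInter fun hc =>
    isClosed_iInter fun _ => ?_
  have hg := memLp_gradient_test (D := D) hφ hc
  have hφ2 : MemLp φ 2 (volume.restrict D) :=
    (hφ.continuous.memLp_of_hasCompactSupport (μ := volume) hc).restrict D
  set B : ℝ →L[ℝ] Space M →L[ℝ] Space M := ContinuousLinearMap.lsmul ℝ ℝ
  have h1 : ∀ p : L2Pair D, ∫ x in D, p.fst x • gradient φ x
      = B.lpPairing (volume.restrict D) 2 2 p.fst hg.toLp := fun p => by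
    rw [ContinuousLinearMap.lpPairing_eq_integral]
    refine integral_congr_ae ?_
    filter_upwards [hg.coeFn_toLp] with x hx
    rw [hx, ContinuousLinearMap.lsmul_apply]
  have h2 : ∀ p : L2Pair D, ∫ x in D, φ x • p.snd x
      = B.lpPairing (volume.restrict D) 2 2 hφ2.toLp p.snd := fun p => by
    rw [ContinuousLinearMap.lpPairing_eq_integral]
    refine integral_congr_ae ?_
    filter_upwards [hφ2.coeFn_toLp] with x hx
    rw [hx, ContinuousLinearMap.lsmul_apply]
  simp only [h1, h2]
  refine isClosed_eq ?_ ?_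
  · exact (ContinuousLinearMap.continuous _).clm_apply continuous_const |>.comp
      (WithLp.fstL 2 ℝ (Lp ℝ 2 (volume.restrict D)) (Lp (Space M) 2 (volume.restrict D))).continuous
  · exact ((ContinuousLinearMap.continuous _).comp
      (WithLp.sndL 2 ℝ (Lp ℝ 2 (volume.restrict D))
        (Lp (Space M) 2 (volume.restrict D))).continuous).neg

instance instCompleteSpaceH1 (D : Set (Space M)) : CompleteSpace (H1 D) :=
  (isClosed_sobolevH1 D).completeSpace_coe

theorem volume_restrict_le_coeffMeasure (hsub : Ω₁ ⊆ Ω) :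
    volume.restrict Ω₁ ≤ coeffMeasure Ω Ω₁ :=
  (Measure.restrict_mono hsub le_rfl).trans (Measure.le_add_right le_rfl)

theorem surfaceMeasure_le_coeffMeasure : surfaceMeasure Ω₁ ≤ coeffMeasure Ω Ω₁ :=
  Measure.le_add_left le_rfl

/-- `(a, u, v) ↦ ∫_{Ω₁} a ∇u·∇v + ∫_{∂Ω₁} a γ u v`, the part of the form of the Robin problem
that depends on the coefficient. -/
noncomputable def principalForm (hsub : Ω₁ ⊆ Ω) (γ : ℝ) :
    Coeff Ω Ω₁ →L[ℝ] H1 Ω₁ →L[ℝ] H1 Ω₁ →L[ℝ] ℝ :=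
  pullbackForm (H1.gradL Ω₁)
      (weightedInner _ (Space M) ∘L restrictLpTop (volume_restrict_le_coeffMeasure hsub))
    + γ • pullbackForm (trace Ω₁)
      (weightedInner _ ℝ ∘L restrictLpTop surfaceMeasure_le_coeffMeasure)

/-- `(u, v) ↦ ∫_{Ω₁} β u v`. -/
noncomputable def zeroOrderForm (β : Lp ℝ ∞ (volume.restrict Ω₁)) : H1 Ω₁ →L[ℝ] H1 Ω₁ →L[ℝ] ℝ :=
  pullbackForm (H1.fnL Ω₁) (weightedInner _ ℝ) β

theorem principalForm_apply (hsub : Ω₁ ⊆ Ω) (γ : ℝ) (a : Coeff Ω Ω₁) (u v : H1 Ω₁) :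
    principalForm hsub γ a u v
      = weightedInner _ (Space M) (restrictLpTop (volume_restrict_le_coeffMeasure hsub) a)
          u.grad v.grad
        + γ * weightedInner _ ℝ (restrictLpTop surfaceMeasure_le_coeffMeasure a)
          (trace Ω₁ u) (trace Ω₁ v) := rfl

theorem zeroOrderForm_apply (β : Lp ℝ ∞ (volume.restrict Ω₁)) (u v : H1 Ω₁) :
    zeroOrderForm β u v = weightedInner _ ℝ β u.fn v.fn := rfl

theorem robinForm_eq (hsub : Ω₁ ⊆ Ω) (γ : ℝ) {b : Space M → ℝ}
    (hb : MemLp b ∞ (volume.restrict Ω₁)) (a : Coeff Ω Ω₁) (u v : H1 Ω₁) :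
    robinForm γ b a u v = (principalForm hsub γ a - zeroOrderForm hb.toLp) u v := by
  rw [sub_apply, sub_apply, principalForm_apply, zeroOrderForm_apply,
    weightedInner_apply, weightedInner_apply, weightedInner_apply, ← integral_const_mul, robinForm]
  refine congr_arg₂ _ (congr_arg₂ _ ?_ ?_) ?_
  · refine integral_congr_ae ?_
    filter_upwards [coeFn_restrictLpTop (volume_restrict_le_coeffMeasure hsub) a] with x hx
    rw [hx]
  · refine integral_congr_ae ?_
    filter_upwards [coeFn_restrictLpTop (surfaceMeasure_le_coeffMeasure (Ω := Ω)) a] with x hx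
    rw [hx, RCLike.inner_apply, conj_trivial]
    ring
  · refine integral_congr_ae ?_
    filter_upwards [hb.coeFn_toLp] with x hx
    rw [hx, RCLike.inner_apply, conj_trivial]
    ring

/-- The form of the Robin problem is coercive, by the Friedrichs inequality, since the zeroth
order coefficient is below the threshold `aLo * min 1 γ / CF`. -/
theorem robinForm_coercive (hsub : Ω₁ ⊆ Ω) {γ aLo bHi CF : ℝ} (hγ : 0 < γ) (haLo : 0 < aLo)
    (hCF : 0 < CF)
    (hFriedrichs : ∀ v : H1 Ω₁, ‖v‖ ^ 2 ≤
      CF * ((∫ x in Ω₁, ‖v.grad x‖ ^ 2) + ∫ x, trace Ω₁ v x ^ 2 ∂(surfaceMeasure Ω₁)))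
    {β : Lp ℝ ∞ (volume.restrict Ω₁)} (hbHi : 0 ≤ bHi) (hβ : ∀ᵐ x ∂(volume.restrict Ω₁), β x ≤ bHi)
    {a : Coeff Ω Ω₁} (ha : ∀ᵐ x ∂(coeffMeasure Ω Ω₁), aLo ≤ a x) (v : H1 Ω₁) :
    (aLo * min 1 γ / CF - bHi) * ‖v‖ ^ 2 ≤ (principalForm hsub γ a - zeroOrderForm β) v v := by
  have h1 : aLo * ‖v.grad‖ ^ 2 ≤ weightedInner _ (Space M)
      (restrictLpTop (volume_restrict_le_coeffMeasure hsub) a) v.grad v.grad := by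
    refine mul_norm_sq_le_weightedInner ?_ _
    filter_upwards [coeFn_restrictLpTop (volume_restrict_le_coeffMeasure hsub) a,
      ae_mono (volume_restrict_le_coeffMeasure hsub) ha] with x hx hax
    rwa [hx]
  have h2 : aLo * ‖trace Ω₁ v‖ ^ 2 ≤ weightedInner _ ℝ
      (restrictLpTop surfaceMeasure_le_coeffMeasure a) (trace Ω₁ v) (trace Ω₁ v) := by
    refine mul_norm_sq_le_weightedInner ?_ _
    filter_upwards [coeFn_restrictLpTop (surfaceMeasure_le_coeffMeasure (Ω := Ω)) a,
      ae_mono (surfaceMeasure_le_coeffMeasure (Ω := Ω)) ha] with x hx hax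
    rwa [hx]
  have h3 := weightedInner_le_mul_norm_sq hβ v.fn
  have h4 : bHi * ‖v.fn‖ ^ 2 ≤ bHi * ‖v‖ ^ 2 := by
    rw [H1.norm_sq_eq]
    gcongr
    exact le_add_of_nonneg_right (sq_nonneg _)
  have h5 : ‖v‖ ^ 2 ≤ CF * (‖v.grad‖ ^ 2 + ‖trace Ω₁ v‖ ^ 2) := by
    have h6 := mul_norm_sq_eq_integral 1 v.grad
    have h7 := mul_norm_sq_eq_integral 1 (trace Ω₁ v)
    simp only [one_mul, real_inner_self_eq_norm_sq, Real.norm_eq_abs, sq_abs] at h6 h7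
    rw [h6, h7]
    exact hFriedrichs v
  have h8 : aLo * min 1 γ / CF * ‖v‖ ^ 2
      ≤ aLo * ‖v.grad‖ ^ 2 + γ * (aLo * ‖trace Ω₁ v‖ ^ 2) := by
    have h9 : 0 < min 1 γ := lt_min one_pos hγ
    calc aLo * min 1 γ / CF * ‖v‖ ^ 2
        ≤ aLo * min 1 γ / CF * (CF * (‖v.grad‖ ^ 2 + ‖trace Ω₁ v‖ ^ 2)) := by gcongr
      _ = min 1 γ * (aLo * ‖v.grad‖ ^ 2) + min 1 γ * (aLo * ‖trace Ω₁ v‖ ^ 2) := by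
          field_simp
      _ ≤ 1 * (aLo * ‖v.grad‖ ^ 2) + γ * (aLo * ‖trace Ω₁ v‖ ^ 2) := by
          gcongr
          · exact min_le_left _ _
          · exact min_le_right _ _
      _ = _ := by rw [one_mul]
  rw [sub_apply, sub_apply, principalForm_apply, zeroOrderForm_apply, sub_mul]
  have h10 := mul_le_mul_of_nonneg_left h2 hγ.le
  linarith

/-- `v ↦ ∫_{Ω₁} φ v` for `φ ∈ L²(Ω₁)`. -/
noncomputable def loadFunctional (φ : Lp ℝ 2 (volume.restrict Ω₁)) : StrongDual ℝ (H1 Ω₁) :=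
  innerSL ℝ φ ∘L H1.fnL Ω₁

theorem loadFunctional_toLp {f : Space M → ℝ} (hf : MemLp f 2 (volume.restrict Ω₁)) (v : H1 Ω₁) :
    loadFunctional hf.toLp v = ∫ x in Ω₁, f x * v.fn x := by
  change ⟪hf.toLp, v.fn⟫_ℝ = _
  rw [L2.inner_def]
  refine integral_congr_ae ?_
  filter_upwards [hf.coeFn_toLp] with x hx
  rw [hx, RCLike.inner_apply, conj_trivial, mul_comm]

theorem isWeakSolution_solutionMap (hsub : Ω₁ ⊆ Ω) {γ c : ℝ} {b f : Space M → ℝ}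
    (hb : MemLp b ∞ (volume.restrict Ω₁)) (hf : MemLp f 2 (volume.restrict Ω₁))
    {a : Coeff Ω Ω₁} (hc : 0 < c)
    (hcoer : ∀ v, c * ‖v‖ ^ 2 ≤ (principalForm hsub γ a - zeroOrderForm hb.toLp) v v) :
    IsWeakSolution γ b f a (solutionMap γ b f a) := by
  obtain ⟨S, hS⟩ := exists_solutionOperator_of_coercive hc hcoer
  have h : ∃! u, IsWeakSolution γ b f a u := by
    refine ⟨S (loadFunctional hf.toLp), fun v => ?_, fun u hu => ?_⟩
    · rw [robinForm_eq hsub γ hb, hS, loadFunctional_toLp]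
    · refine eq_of_coercive hc hcoer fun v => ?_
      rw [hS, ← robinForm_eq, hu v, loadFunctional_toLp]
  rw [solutionMap, dif_pos h]
  exact h.choose_spec.1

/-- The set of coefficients with strict bounds almost everywhere need not be open in `L^∞`, but it
is convex with nonempty interior, which makes derivatives within it unique. -/
theorem uniqueDiffOn_admissible {aLo aHi : ℝ} (h : aLo < aHi) :
    UniqueDiffOn ℝ (admissible Ω Ω₁ aLo aHi) :=
  uniqueDiffOn_convex (convex_setOf_ae_mem (convex_Ioo aLo aHi))
    (nonempty_interior_setOf_ae_mem_Ioo h)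

theorem admissible_subset_closedAdmissible {aLo aHi : ℝ} :
    admissible Ω Ω₁ aLo aHi ⊆ closedAdmissible Ω Ω₁ aLo aHi :=
  fun _ (ha : ∀ᵐ _ ∂_, _) => ha.mono fun _ hx => ⟨hx.1.le, hx.2.le⟩

theorem uniqueDiffOn_closedAdmissible {aLo aHi : ℝ} (h : aLo < aHi) :
    UniqueDiffOn ℝ (closedAdmissible Ω Ω₁ aLo aHi) :=
  uniqueDiffOn_convex (convex_setOf_ae_mem (convex_Icc aLo aHi))
    ((nonempty_interior_setOf_ae_mem_Ioo h).mono
      (interior_mono admissible_subset_closedAdmissible))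

theorem norm_le_of_mem_closedAdmissible {aLo aHi : ℝ} (haLo : 0 ≤ aLo) (h : aLo ≤ aHi)
    {a : Coeff Ω Ω₁} (ha : a ∈ closedAdmissible Ω Ω₁ aLo aHi) : ‖a‖ ≤ aHi := by
  refine norm_le_of_ae_norm_le (haLo.trans h) ?_
  filter_upwards [ha] with x hx
  rw [Real.norm_of_nonneg (haLo.trans hx.1)]
  exact hx.2

theorem norm_principalForm_sub_le (hsub : Ω₁ ⊆ Ω) (γ : ℝ) {aLo aHi : ℝ} (haLo : 0 ≤ aLo)
    (h : aLo ≤ aHi) {N : H1 Ω₁ →L[ℝ] H1 Ω₁ →L[ℝ] ℝ} {a : Coeff Ω Ω₁}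
    (ha : a ∈ closedAdmissible Ω Ω₁ aLo aHi) :
    ‖principalForm hsub γ a - N‖ ≤ ‖principalForm (Ω := Ω) hsub γ‖ * aHi + ‖N‖ :=
  (norm_sub_le _ _).trans <| by
    gcongr
    exact (ContinuousLinearMap.le_opNorm _ _).trans <| by
      gcongr
      exact norm_le_of_mem_closedAdmissible haLo h ha

theorem normL2_eq_norm {g : Space M → ℝ} {φ : Lp ℝ 2 (volume.restrict Ω)}
    (h : φ =ᵐ[volume.restrict Ω] g) : normL2 Ω g = ‖φ‖ := by
  rw [normL2, Lp.norm_def, eLpNorm_congr_ae h]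

end Robin

end RobinTikhonov

theorem theorem3p1 {M : ℕ} (hM : 1 ≤ M)
    (Ω Ω₁ : Set (Space M))
    (hΩ : IsOpen Ω) (hΩb : Bornology.IsBounded Ω)
    (hΩ₁ : IsOpen Ω₁) (hΩ₁c : IsConnected Ω₁) (hsub : Ω₁ ⊆ Ω) (hLip : HasLipschitzBoundary Ω₁)
    (γ aLo aHi bHi CF : ℝ) (hγ : 0 < γ) (haLo : 0 < aLo) (haHi : aLo < aHi)
    (hCF : 0 < CF)
    (hFriedrichs : ∀ v : H1 Ω₁, ‖v‖ ^ 2 ≤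
      CF * ((∫ x in Ω₁, ‖v.grad x‖ ^ 2) + ∫ x, trace Ω₁ v x ^ 2 ∂(surfaceMeasure Ω₁)))
    (hbHi : bHi < aLo * min 1 γ / CF)
    (b f aStar : Space M → ℝ)
    (hb : MemLp b ∞ (volume.restrict Ω))
    (hbpos : ∀ᵐ x ∂(volume.restrict Ω), 0 < b x ∧ b x < bHi)
    (hf : MemLp f ∞ (volume.restrict Ω))
    (haStar : MemLp aStar 2 (volume.restrict Ω))
    (A : Set (Coeff Ω Ω₁))
    (hA : A = admissible Ω Ω₁ aLo aHi ∨ A = closedAdmissible Ω Ω₁ aLo aHi)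
    (uHat : H1 Ω₁) (aPlus : Coeff Ω Ω₁)
    (haPlus : IsMinNormSolution γ b f aStar A uHat aPlus)
    (hsource : ∃ ωStar : StrongDual ℝ (H1 Ω₁), SourceCondition γ b f aStar A aPlus ωStar)
    (c₁ c₂ : ℝ) (hc₁ : 0 < c₁) :
    ∃ C : ℝ, ∀ δ ρ : ℝ, 0 < δ → c₁ * δ ≤ ρ → ρ ≤ c₂ * δ →
      ∀ z : H1 Ω₁, ‖uHat - z‖ ≤ δ →
        ∀ a : Coeff Ω Ω₁, IsTikhonovMinimizer γ b f aStar A ρ z a →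
          normL2 Ω (fun x => a x - aPlus x) ≤ C * √δ ∧
          ‖solutionMap γ b f a - z‖ ≤ C * δ := by
  obtain ⟨ωStar, hω⟩ := hsource
  obtain ⟨haPlusA, rfl, -⟩ := haPlus
  have : IsFiniteMeasure (volume.restrict Ω) :=
    isFiniteMeasure_restrict.2 hΩb.measure_lt_top.ne
  have : IsFiniteMeasure (volume.restrict Ω₁) :=
    isFiniteMeasure_restrict.2 (hΩb.subset hsub).measure_lt_top.ne
  have hsub' : volume.restrict Ω₁ ≤ volume.restrict Ω := Measure.restrict_mono hsub le_rfl
  have hb₁ : MemLp b ∞ (volume.restrict Ω₁) := hb.mono_measure hsub'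
  have hf₁ : MemLp f 2 (volume.restrict Ω₁) :=
    (hf.mono_measure hsub').mono_exponent le_top
  have hclosed : A ⊆ closedAdmissible Ω Ω₁ aLo aHi := by
    rcases hA with rfl | rfl
    · exact admissible_subset_closedAdmissible
    · exact subset_rfl
  have hunique : UniqueDiffWithinAt ℝ A aPlus := by
    rcases hA with rfl | rfl
    · exact uniqueDiffOn_admissible haHi _ haPlusA
    · exact uniqueDiffOn_closedAdmissible haHi _ haPlusA
  -- In fact `0 < bHi`, since `Ω` is not null; with `max bHi 0` this need not be shown.
  have hc : 0 < aLo * min 1 γ / CF - max bHi 0 := by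
    have : 0 < aLo * min 1 γ / CF := div_pos (mul_pos haLo (lt_min one_pos hγ)) hCF
    exact sub_pos.2 (max_lt hbHi this)
  have hβ : ∀ᵐ x ∂(volume.restrict Ω₁), hb₁.toLp b x ≤ max bHi 0 := by
    filter_upwards [hb₁.coeFn_toLp, ae_mono hsub' hbpos] with x hx hbx
    rw [hx]
    exact hbx.2.le.trans (le_max_left _ _)
  have hcoer : ∀ a ∈ A, ∀ v, (aLo * min 1 γ / CF - max bHi 0) * ‖v‖ ^ 2
      ≤ (principalForm hsub γ a - zeroOrderForm hb₁.toLp) v v := fun a ha v =>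
    robinForm_coercive hsub hγ haLo hCF hFriedrichs (le_max_right _ _) hβ
      (Filter.Eventually.mono (hclosed ha) fun _ hx => hx.1) v
  have hU : ∀ a ∈ A, ∀ v, (principalForm hsub γ a - zeroOrderForm hb₁.toLp)
      (solutionMap γ b f a) v = loadFunctional hf₁.toLp v := fun a ha v => by
    rw [← robinForm_eq, loadFunctional_toLp]
    exact isWeakSolution_solutionMap hsub hb₁ hf₁ hc (hcoer a ha) v
  have hle : volume.restrict Ω ≤ coeffMeasure Ω Ω₁ := Measure.le_add_right le_rfl
  have hdiff : ∀ a : Coeff Ω Ω₁, (lpTopToL2 hle a - haStar.toLp : Lp ℝ 2 (volume.restrict Ω))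
      =ᵐ[volume.restrict Ω] fun x => a x - aStar x := fun a => by
    filter_upwards [Lp.coeFn_sub (lpTopToL2 hle a) haStar.toLp, coeFn_lpTopToL2 hle a,
      haStar.coeFn_toLp] with x h1 h2 h3
    rw [h1, Pi.sub_apply, h2, h3]
  obtain ⟨C, hC⟩ := exists_tikhonov_rates hc hcoer
    (fun a ha => norm_principalForm_sub_le hsub γ haLo.le haHi.le (hclosed ha)) hU haPlusA
    hunique (η := ωStar)
    (lpTopToL2 hle) haStar.toLp (fun h => by
      rw [← hω h, L2.inner_def]
      refine integral_congr_ae ?_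
      filter_upwards [hdiff aPlus, coeFn_lpTopToL2 hle h] with x h1 h2
      rw [h1, h2, RCLike.inner_apply, conj_trivial, mul_comm]) c₂ hc₁
  refine ⟨C, fun δ ρ hδ hρ₁ hρ₂ z hz a ha => ?_⟩
  have hmin := ha.2 aPlus haPlusA
  simp only [tikhonov, energyMisfit, robinForm_eq hsub γ hb₁, normL2_eq_norm (hdiff _)] at hmin
  rw [normL2_eq_norm (φ := lpTopToL2 hle a - lpTopToL2 hle aPlus)]
  · exact hC δ ρ hδ hρ₁ hρ₂ z hz a ha.1 hmin
  · filter_upwards [Lp.coeFn_sub (lpTopToL2 hle a) (lpTopToL2 hle aPlus), coeFn_lpTopToL2 hle a,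
      coeFn_lpTopToL2 hle aPlus] with x h1 h2 h3
    rw [h1, Pi.sub_apply, h2, h3]
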